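/- Let $\mathcal G=(V,E,w)$ denote a finite simple graph $(V,E)$ together with binary node flags $w:V\to\{0,1\}$; let $d_v$ be the degree of the node $v$ and $\bar d(\mathcal G)=\frac1{|V|}\sum_{v\in V} d_v$ the average degree. The grammar $\Phi^*=\{r_1,r_2,r_3,r_4\}$ consists of the following rules. * $r_1$: let $i,j$ be adjacent with $d_i>d_j$, and let $h\neq j$ be a neighbor of $i$ that is not adjacent to $j$. Either replace the edge $ih$ by the edge $jh$, or, if $w_i=0$, add the edge $jh$, keep $ih$, and set $w_i=1$. * $r_2$: let $i,j$ be adjacent, $h\ne j$ a neighbor of $i$ not adjacent to $j$, and $f\neq i$ a neighbor of $j$ not adjacent to $i$. Replace the edges $ih,jf$ by $if,jh$. * $r_3$: let $i,j,h$ be pairwise adjacent with $d_i>d_j$ and $w_i=1$. Remove the edge $ih$ and set $w_i=0$. * $r_4$: let $i,j$ be adjacent. Swap $w_i$ and $w_j$. A concurrent application of $\Phi^*$ to a graph simultaneously applies a (possibly empty) set of applicable rule instances whose sets of participating nodes are pairwise disjoint; applicability is judged on the current graph. The system $(\mathcal G,\Phi^*)$ is run as a random process $(\mathcal G(t))_{t\ge0}$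 with $\mathcal G(0)=\mathcal G$: a time-homogeneous Markov chain on the labeled graphs on $V$, with arbitrary transition probabilities such that (a) every transition of positive probability is a concurrent application of $\Phi^*$, and (b) every transition to a different labeled graph that results from the application of a single rule instance has positive probability. (In particular, this covers every chain whose transitions of positive probability are exactly the concurrent applications of $\Phi^*$.) **Lemma.** Let $\mathcal G=(V,E,\mathbf 0)$ be connected with $\bar d(\mathcal G)>2$. Then, for every such process, almost surely there are a time $t$ and an integer $m$ with $\bar d(\mathcal G)\le m\le\bar d(\mathcal G)+2$ such that $\mathcal G(t)$ is $m$-regular. -/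

import Mathlib

/-- A labeled graph `(V, E, w)`: a simple graph with a binary flag at every node.  The degree part
of a node label is encoded by the graph itself. -/
@[ext]
structure LabeledGraph (V : Type*) where
  graph : SimpleGraph V
  flag : V → Fin 2

namespace LabeledGraph

open Classical in
/-- The degree `d_v` of a node. -/
noncomputable def deg {V : Type*} [Fintype V] (x : LabeledGraph V) (v : V) : ℕ :=
  x.graph.degree v

/-- The graph underlying `x` is `m`-regular. -/
def IsRegular {V : Type*} [Fintype V] (x : LabeledGraph V) (m : ℕ) : Prop :=
  ∀ v, x.deg v = m

/-- The average degree. -/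
noncomputable def avgDegree {V : Type*} [Fintype V] (x : LabeledGraph V) : ℝ :=
  (∑ v, (x.deg v : ℝ)) / (Fintype.card V : ℝ)

end LabeledGraph

/-- The instances of the rules `r₁, r₂, r₃, r₄`, given by the nodes that play the roles
`i, j, h, f`.  The rule `r₁` has two possible outcomes: the edge `ih` is either dropped
(`r1Rewire`) or kept (`r1Add`). -/
inductive RuleInstance (V : Type*) where
  | r1Rewire (i j h : V)
  | r1Add (i j h : V)
  | r2 (i j h f : V)
  | r3 (i j h : V)
  | r4 (i j : V)

namespace RuleInstance

/-- The participating nodes. -/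
def nodes {V : Type*} : RuleInstance V → Set V
  | r1Rewire i j h => {i, j, h}
  | r1Add i j h => {i, j, h}
  | r2 i j h f => {i, j, h, f}
  | r3 i j h => {i, j, h}
  | r4 i j => {i, j}

/-- When the rule instance is applicable to `x`. -/
def Applicable {V : Type*} [Fintype V] (x : LabeledGraph V) : RuleInstance V → Prop
  | r1Rewire i j h =>
      x.graph.Adj i j ∧ x.deg j < x.deg i ∧ x.graph.Adj i h ∧ h ≠ j ∧ ¬ x.graph.Adj j h
  | r1Add i j h =>
      x.graph.Adj i j ∧ x.deg j < x.deg i ∧ x.graph.Adj i h ∧ h ≠ j ∧ ¬ x.graph.Adj j h ∧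
        x.flag i = 0
  | r2 i j h f =>
      x.graph.Adj i j ∧ x.graph.Adj i h ∧ h ≠ j ∧ ¬ x.graph.Adj j h ∧
        x.graph.Adj j f ∧ f ≠ i ∧ ¬ x.graph.Adj i f
  | r3 i j h =>
      x.graph.Adj i j ∧ x.deg j < x.deg i ∧ x.graph.Adj i h ∧ x.graph.Adj j h ∧ x.flag i = 1
  | r4 i j => x.graph.Adj i j

/-- The edges deleted by the rule instance. -/
def removed {V : Type*} : RuleInstance V → Set (Sym2 V)
  | r1Rewire i _ h => {s(i, h)}
  | r1Add _ _ _ => ∅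
  | r2 i j h f => {s(i, h), s(j, f)}
  | r3 i _ h => {s(i, h)}
  | r4 _ _ => ∅

/-- The edges created by the rule instance. -/
def added {V : Type*} : RuleInstance V → Set (Sym2 V)
  | r1Rewire _ j h => {s(j, h)}
  | r1Add _ j h => {s(j, h)}
  | r2 i j h f => {s(i, f), s(j, h)}
  | r3 _ _ _ => ∅
  | r4 _ _ => ∅

open Classical in
/-- The flags after the rule instance has acted on the flags `w`. -/
noncomputable def newFlag {V : Type*} (w : V → Fin 2) : RuleInstance V → V → Fin 2
  | r1Rewire _ _ _ => w
  | r1Add i _ _ => Function.update w i 1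
  | r2 _ _ _ _ => w
  | r3 i _ _ => Function.update w i 0
  | r4 i j => w ∘ Equiv.swap i j

end RuleInstance

/-- The concurrent application of the rule instances in `S`, which are all applicable to `x` and
involve pairwise disjoint sets of nodes, transforms `x` into `y`. -/
structure AppliesTo {V : Type*} [Fintype V] (S : Set (RuleInstance V))
    (x y : LabeledGraph V) : Prop where
  applicable : ∀ r ∈ S, r.Applicable x
  disjoint : S.PairwiseDisjoint RuleInstance.nodes
  edges : y.graph.edgeSet =
    (x.graph.edgeSet \ ⋃ r ∈ S, r.removed) ∪ ⋃ r ∈ S, r.added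
  flag_of_mem : ∀ r ∈ S, ∀ v ∈ r.nodes, y.flag v = r.newFlag x.flag v
  flag_of_notMem : ∀ v, (∀ r ∈ S, v ∉ r.nodes) → y.flag v = x.flag v

/-- A memoryless randomized execution of the grammar.  Only concurrent applications of rules
(including the empty one, in which nothing happens) have positive probability, and every
state-changing application of a single rule does have positive probability.  The latter holds in
particular if all feasible concurrent applications have positive probability. -/
structure IsRandomExecution {V : Type*} [Fintype V]
    (P : LabeledGraph V → PMF (LabeledGraph V)) : Prop where
  feasible : ∀ x y, P x y ≠ 0 → ∃ S, AppliesTo S x y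
  positive : ∀ x y r, x ≠ y → AppliesTo {r} x y → P x y ≠ 0

/-- `X` is, under `μ`, a time-homogeneous Markov chain on the countable state space `S` with
initial state `x₀` and transition probabilities `P`. -/
structure IsMarkovChain {Ω S : Type*} [MeasurableSpace Ω] (μ : MeasureTheory.Measure Ω)
    (X : ℕ → Ω → S) (x₀ : S) (P : S → PMF S) : Prop where
  measurable : ∀ t x, MeasurableSet (X t ⁻¹' {x})
  init : ∀ᵐ ω ∂μ, X 0 ω = x₀
  step : ∀ (t : ℕ) (x : ℕ → S),
    μ {ω | ∀ s ≤ t + 1, X s ω = x s} = μ {ω | ∀ s ≤ t, X s ω = x s} * P (x t) (x (t + 1))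

/-! Every rule changes the number of edges and the number of raised flags by the same amount, so
`size - flagSum` is invariant and always equals the initial edge count `c`. With `n` nodes, the size
therefore stays in `[c, c + n]`. This interval contains a multiple `q * n` with `q * n < c + n`, and
average degree above 2 gives `q ≥ 2`. At size `q * n` the average degree is the integer `2 * q`, so
a graph whose degrees differ by at most one is regular.

From every reachable state a regular graph is reachable. Connectivity is preserved, and rewirings
lower the sum of squared degrees until the degrees differ by at most one
(`exists_rearranges_balanced`). If the graph is still irregular, its size is not `q * n`. Below that
value some flag is down; swaps carry it to a node with a neighbor of smaller degree, where an edge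
can be added (`exists_reach_size_succ`). Above it some flag is up and all degrees are at least 3;
flag-preserving moves create a triangle with unequal degrees, from which an edge can be removed
(`exists_reach_size_pred`). Each round brings the size closer to `q * n`, so the process stops
(`exists_reach_isRegular`).

The state space is finite, and a finite chain almost surely hits a set accessible from every state
that it can reach (`IsMarkovChain.ae_exists_mem`). The bounds on the size bound the degree `m`,
wherever in the interval regularity occurs. -/

/-! ### Effect of a single rule instance -/

namespace RuleInstance

/-- The labeled graph obtained from `x` by applying the single rule instance `r`. -/
noncomputable def result {V : Type*} (r : RuleInstance V) (x : LabeledGraph V) :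
    LabeledGraph V where
  graph := SimpleGraph.fromEdgeSet ((x.graph.edgeSet \ r.removed) ∪ r.added)
  flag := r.newFlag x.flag

lemma result_adj {V : Type*} (r : RuleInstance V) (x : LabeledGraph V) (u v : V) :
    (r.result x).graph.Adj u v ↔
      ((x.graph.Adj u v ∧ s(u, v) ∉ r.removed) ∨ s(u, v) ∈ r.added) ∧ u ≠ v := by
  rw [result, SimpleGraph.fromEdgeSet_adj]
  rfl

lemma mem_nodes_of_mem_removed {V : Type*} {r : RuleInstance V} {e : Sym2 V} {v : V}
    (he : e ∈ r.removed) (hv : v ∈ e) : v ∈ r.nodes := by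
  cases r <;> simp only [removed, Set.mem_singleton_iff, Set.mem_insert_iff,
    Set.mem_empty_iff_false] at he <;> simp only [nodes] <;> aesop

lemma mem_nodes_of_mem_added {V : Type*} {r : RuleInstance V} {e : Sym2 V} {v : V}
    (he : e ∈ r.added) (hv : v ∈ e) : v ∈ r.nodes := by
  cases r <;> simp only [added, Set.mem_singleton_iff, Set.mem_insert_iff,
    Set.mem_empty_iff_false] at he <;> simp only [nodes] <;> aesop

lemma newFlag_of_notMem {V : Type*} {r : RuleInstance V} {w : V → Fin 2} {v : V}
    (hv : v ∉ r.nodes) : r.newFlag w v = w v := by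
  cases r <;> simp_all [nodes, newFlag, Function.update, Equiv.swap_apply_of_ne_of_ne]

lemma newFlag_congr {V : Type*} {r : RuleInstance V} {w w' : V → Fin 2}
    (h : ∀ v ∈ r.nodes, w v = w' v) {v : V} (hv : v ∈ r.nodes) :
    r.newFlag w v = r.newFlag w' v := by
  cases r with
  | r4 i j =>
    simp only [nodes, Set.mem_insert_iff, Set.mem_singleton_iff] at hv h
    rcases hv with rfl | rfl <;> simp [newFlag, h]
  | _ => simp_all [newFlag, Function.update]

lemma not_isDiag_of_mem_added {V : Type*} [Fintype V] {r : RuleInstance V} {x : LabeledGraph V}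
    (hr : r.Applicable x) {e : Sym2 V} (he : e ∈ r.added) : ¬ e.IsDiag := by
  cases r <;> simp only [added, Set.mem_singleton_iff, Set.mem_insert_iff,
    Set.mem_empty_iff_false] at he <;> simp only [Applicable] at hr <;> aesop

lemma result_edgeSet {V : Type*} [Fintype V] {r : RuleInstance V} {x : LabeledGraph V}
    (hr : r.Applicable x) :
    (r.result x).graph.edgeSet = (x.graph.edgeSet \ r.removed) ∪ r.added := by
  rw [result, SimpleGraph.edgeSet_fromEdgeSet, sdiff_eq_left, Set.disjoint_left]
  rintro e (he | he) hd
  · exact SimpleGraph.not_isDiag_of_mem_edgeSet _ he.1 hd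
  · exact not_isDiag_of_mem_added hr he hd

lemma appliesTo_result {V : Type*} [Fintype V] {r : RuleInstance V} {x : LabeledGraph V}
    (hr : r.Applicable x) : AppliesTo {r} x (r.result x) where
  applicable := by simpa using hr
  disjoint := Set.pairwiseDisjoint_singleton _ _
  edges := by simpa using result_edgeSet hr
  flag_of_mem := by simp [result]
  flag_of_notMem v hv := newFlag_of_notMem (hv r rfl)

lemma result_adj_of_notMem {V : Type*} {r : RuleInstance V} {x : LabeledGraph V} {u v : V}
    (h : ¬ (u ∈ r.nodes ∧ v ∈ r.nodes)) : (r.result x).graph.Adj u v ↔ x.graph.Adj u v := by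
  have h1 : s(u, v) ∉ r.removed := fun he =>
    h ⟨mem_nodes_of_mem_removed he (by simp), mem_nodes_of_mem_removed he (by simp)⟩
  have h2 : s(u, v) ∉ r.added := fun he =>
    h ⟨mem_nodes_of_mem_added he (by simp), mem_nodes_of_mem_added he (by simp)⟩
  rw [result_adj]
  simp only [h1, h2, not_false_eq_true, and_true, or_false]
  exact ⟨fun h => h.1, fun h => ⟨h, h.ne⟩⟩

end RuleInstance

/-! ### Degrees, reachability, edge and flag counts -/

namespace LabeledGraph

lemma deg_eq_ncard {V : Type*} [Fintype V] (x : LabeledGraph V) (v : V) :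
    x.deg v = (x.graph.neighborSet v).ncard := by
  classical
  rw [deg, ← SimpleGraph.card_neighborSet_eq_degree, ← Nat.card_eq_fintype_card,
    Nat.card_coe_set_eq]

lemma deg_congr {V : Type*} [Fintype V] {x y : LabeledGraph V} {v : V}
    (h : ∀ u, x.graph.Adj v u ↔ y.graph.Adj v u) : x.deg v = y.deg v := by
  rw [deg_eq_ncard, deg_eq_ncard]
  congr 1
  ext u
  exact h u

/-- `y` arises from `x` by applying a single rule instance. -/
def Step {V : Type*} [Fintype V] (x y : LabeledGraph V) : Prop :=
  ∃ r : RuleInstance V, r.Applicable x ∧ y = r.result x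

/-- `y` arises from `x` by successively applying finitely many rule instances. -/
abbrev Reach {V : Type*} [Fintype V] : LabeledGraph V → LabeledGraph V → Prop :=
  Relation.ReflTransGen Step

/-- The number of edges. -/
noncomputable def size {V : Type*} (x : LabeledGraph V) : ℕ := x.graph.edgeSet.ncard

/-- The number of raised flags. -/
def flagSum {V : Type*} [Fintype V] (x : LabeledGraph V) : ℕ := ∑ v, (x.flag v : ℕ)

lemma sum_deg {V : Type*} [Fintype V] (x : LabeledGraph V) : ∑ v, x.deg v = 2 * x.size := by
  classical
  rw [size, ← SimpleGraph.coe_edgeFinset, Set.ncard_coe_finset,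
    ← SimpleGraph.sum_degrees_eq_twice_card_edges]
  refine Finset.sum_congr rfl fun v _ => ?_
  rw [deg]

lemma flagSum_le {V : Type*} [Fintype V] (x : LabeledGraph V) : x.flagSum ≤ Fintype.card V := by
  have h : x.flagSum ≤ ∑ _v : V, 1 := Finset.sum_le_sum fun v _ => by omega
  simpa using h

instance {V : Type*} [Finite V] : Finite (LabeledGraph V) :=
  Finite.of_injective (fun x : LabeledGraph V => (x.graph, x.flag))
    fun _ _ h => LabeledGraph.ext (congrArg Prod.fst h) (congrArg Prod.snd h)

end LabeledGraph

/-! ### Serializing concurrent applications -/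

namespace RuleInstance

open LabeledGraph

lemma deg_result_of_notMem {V : Type*} [Fintype V] {r : RuleInstance V} {x : LabeledGraph V}
    {v : V} (hv : v ∉ r.nodes) : (r.result x).deg v = x.deg v :=
  deg_congr fun _ => result_adj_of_notMem fun h => hv h.1

lemma Applicable.result_of_disjoint {V : Type*} [Fintype V] {r s : RuleInstance V}
    {x : LabeledGraph V} (hs : s.Applicable x) (h : Disjoint r.nodes s.nodes) :
    s.Applicable (r.result x) := by
  have hn : ∀ v ∈ s.nodes, v ∉ r.nodes := fun v hv hv' => Set.disjoint_left.1 h hv' hv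
  have ha : ∀ v ∈ s.nodes, ∀ w, (r.result x).graph.Adj v w ↔ x.graph.Adj v w :=
    fun v hv w => result_adj_of_notMem fun h => hn v hv h.1
  have hd : ∀ v ∈ s.nodes, (r.result x).deg v = x.deg v :=
    fun v hv => deg_result_of_notMem (hn v hv)
  have hf : ∀ v ∈ s.nodes, (r.result x).flag v = x.flag v :=
    fun v hv => newFlag_of_notMem (hn v hv)
  cases s <;> simp_all [Applicable, nodes]

instance {V : Type*} [Finite V] : Finite (RuleInstance V) := by
  let f : RuleInstance V → Fin 5 × V × V × V × V
    | r1Rewire i j h => (0, i, j, h, h)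
    | r1Add i j h => (1, i, j, h, h)
    | r2 i j h f => (2, i, j, h, f)
    | r3 i j h => (3, i, j, h, h)
    | r4 i j => (4, i, j, j, j)
  refine Finite.of_injective f fun r s h => ?_
  cases r <;> cases s <;> simp_all [f]

end RuleInstance

namespace AppliesTo

open RuleInstance LabeledGraph

lemma eq_of_empty {V : Type*} [Fintype V] {x y : LabeledGraph V} (h : AppliesTo ∅ x y) :
    x = y := by
  refine LabeledGraph.ext ?_ (funext fun v => (h.flag_of_notMem v (by simp)).symm)
  rw [← SimpleGraph.edgeSet_inj, h.edges]
  simp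

/-- Disjoint node sets make the instances independent, so one of them can be carried out first and
the others remain a valid concurrent application. -/
lemma of_insert {V : Type*} [Fintype V] {x y : LabeledGraph V} {r : RuleInstance V}
    {S : Set (RuleInstance V)} (h : AppliesTo (insert r S) x y) (hr : r ∉ S) :
    AppliesTo S (r.result x) y := by
  have hd : ∀ s ∈ S, Disjoint r.nodes s.nodes := fun s hs =>
    h.disjoint (Set.mem_insert _ _) (Set.mem_insert_of_mem _ hs) (fun e => hr (e ▸ hs))
  refine ⟨fun s hs => (h.applicable s (Set.mem_insert_of_mem _ hs)).result_of_disjoint (hd s hs),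
    h.disjoint.subset (Set.subset_insert _ _), ?_, ?_, ?_⟩
  · rw [h.edges, result_edgeSet (h.applicable r (Set.mem_insert _ _)), Set.biUnion_insert,
      Set.biUnion_insert]
    -- The only obstruction to reordering deletions and additions would be an edge created by `r`
    -- and deleted by a later instance.
    have hdis : ∀ e ∈ r.added, e ∉ ⋃ s ∈ S, s.removed := by
      intro e he he'
      obtain ⟨s, hs, he'⟩ := Set.mem_iUnion₂.1 he'
      induction e with
      | h a b => exact Set.disjoint_left.1 (hd s hs) (mem_nodes_of_mem_added he (by simp))
                  (mem_nodes_of_mem_removed he' (Sym2.mem_mk_left a b))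
    ext e
    have := hdis e
    simp only [Set.mem_union, Set.mem_sdiff] at this ⊢
    tauto
  · intro s hs v hv
    rw [h.flag_of_mem s (Set.mem_insert_of_mem _ hs) v hv]
    exact newFlag_congr (fun u hu =>
      (newFlag_of_notMem fun hu' => Set.disjoint_left.1 (hd s hs) hu' hu).symm) hv
  · intro v hv
    by_cases hvr : v ∈ r.nodes
    · exact h.flag_of_mem r (Set.mem_insert _ _) v hvr
    · refine (h.flag_of_notMem v ?_).trans (newFlag_of_notMem hvr).symm
      rintro s (rfl | hs)
      exacts [hvr, hv s hs]

lemma reach {V : Type*} [Fintype V] {S : Set (RuleInstance V)} {x y : LabeledGraph V}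
    (h : AppliesTo S x y) : Reach x y := by
  induction S, S.toFinite using Set.Finite.induction_on generalizing x with
  | empty => rw [h.eq_of_empty]
  | @insert r S hr _ ih =>
    exact (ih (h.of_insert hr)).head ⟨r, h.applicable r (Set.mem_insert _ _), rfl⟩

end AppliesTo

/-! ### Invariants: connectivity, and edges minus flags -/

namespace LabeledGraph

open RuleInstance

lemma connected_of_adj_reachable {V : Type*} {G H : SimpleGraph V} (hG : G.Connected)
    (h : ∀ u v, G.Adj u v → H.Reachable u v) : H.Connected := by
  have := hG.nonempty
  refine ⟨fun u v => ?_⟩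
  obtain ⟨p⟩ := hG.preconnected u v
  induction p with
  | nil => exact SimpleGraph.Reachable.refl _
  | cons hadj _ ih => exact (h _ _ hadj).trans ih

/-- The endpoints of a deleted edge stay joined by a path of length two in the new graph, whose
middle node is `i` or `j`. -/
lemma Step.connected {V : Type*} [Fintype V] {x y : LabeledGraph V} (h : Step x y)
    (hx : x.graph.Connected) : y.graph.Connected := by
  obtain ⟨r, hr, rfl⟩ := h
  refine connected_of_adj_reachable hx fun u v huv => ?_
  by_cases he : s(u, v) ∈ r.removed
  · have key : ∀ a b c : V, (r.result x).graph.Adj a b → (r.result x).graph.Adj b c →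
        s(u, v) = s(a, c) → (r.result x).graph.Reachable u v := by
      intro a b c hab hbc hac
      have hr := hab.reachable.trans hbc.reachable
      rcases Sym2.eq_iff.1 hac with ⟨rfl, rfl⟩ | ⟨rfl, rfl⟩
      exacts [hr, hr.symm]
    cases r with
    | r1Rewire i j h =>
      obtain ⟨h1, h2, h3, h4, h5⟩ := hr
      refine key i j h ?_ ?_ he <;>
        simp_all [result_adj, removed, added, h1.ne, h1.ne', Ne.symm h4]
    | r2 i j h f =>
      obtain ⟨h1, h2, h3, h4, h5, h6, h7⟩ := hr
      have := h1.ne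
      have hfh : f ≠ h := fun e => h4 (e ▸ h5)
      rcases he with he | he
      · refine key i j h ?_ ?_ he <;> simp_all [result_adj, removed, added, h1.ne, h1.ne', eq_comm]
      · refine key j i f ?_ ?_ he <;> simp_all [result_adj, removed, added, h1.ne, h1.ne', eq_comm,
          h1.symm]
    | r3 i j h =>
      obtain ⟨h1, h2, h3, h4, h5⟩ := hr
      refine key i j h ?_ ?_ he <;>
        simp_all [result_adj, removed, added, h1.ne, h1.ne', h4.ne, h3.ne, h3.ne']
    | _ => simp [removed] at he
  · exact SimpleGraph.Adj.reachable ((result_adj _ _ _ _).2 ⟨Or.inl ⟨huv, he⟩, huv.ne⟩)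

lemma size_r1Add {V : Type*} [Fintype V] {x : LabeledGraph V} {i j h : V}
    (hr : (r1Add i j h).Applicable x) : ((r1Add i j h).result x).size = x.size + 1 := by
  rw [size, result_edgeSet hr]
  simp only [removed, added, Set.sdiff_empty, Set.union_singleton]
  exact Set.ncard_insert_of_notMem hr.2.2.2.2.1 (Set.toFinite _)

lemma size_r3 {V : Type*} [Fintype V] {x : LabeledGraph V} {i j h : V}
    (hr : (r3 i j h).Applicable x) : ((r3 i j h).result x).size + 1 = x.size := by
  rw [size, result_edgeSet hr]
  simp only [removed, added, Set.union_empty]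
  exact Set.ncard_sdiff_singleton_add_one hr.2.2.1 (Set.toFinite _)

/-- Adding an edge raises one flag, removing one lowers one flag, and the other rules change neither
count. The equation is written additively to avoid truncated subtraction. -/
lemma Step.size_add_flagSum {V : Type*} [Fintype V] {x y : LabeledGraph V} (h : Step x y) :
    y.size + x.flagSum = x.size + y.flagSum := by
  classical
  obtain ⟨r, hr, rfl⟩ := h
  have upd : ∀ (i : V) (w : V → Fin 2), (∀ v, v ≠ i → w v = x.flag v) →
      ∑ v, (w v : ℕ) + (x.flag i : ℕ) = x.flagSum + w i := by
    intro i w hw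
    rw [flagSum, ← Finset.add_sum_erase _ _ (Finset.mem_univ i),
      ← Finset.add_sum_erase _ (fun v => (x.flag v : ℕ)) (Finset.mem_univ i),
      Finset.sum_congr rfl (g := fun v => (x.flag v : ℕ))
        fun v hv => by rw [hw v (Finset.ne_of_mem_erase hv)]]
    omega
  cases r with
  | r1Rewire i j h =>
    have : ((r1Rewire i j h).result x).size = x.size := by
      rw [size, result_edgeSet hr]
      obtain ⟨h1, h2, h3, h4, h5⟩ := hr
      simp only [removed, added, Set.union_singleton]
      rw [Set.ncard_insert_of_notMem (fun hm => h5 hm.1) (Set.toFinite _)]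
      exact Set.ncard_sdiff_singleton_add_one h3 (Set.toFinite _)
    rw [this]; rfl
  | r1Add i j h =>
    have h1 := upd i ((r1Add i j h).result x).flag fun v hv => by
      simp [result, newFlag, hv]
    have h2 : ((r1Add i j h).result x).flag i = 1 := by simp [result, newFlag]
    have h3 := size_r1Add hr
    rw [h2, hr.2.2.2.2.2, ← flagSum] at h1
    simp only [Fin.val_zero, Fin.val_one] at h1
    omega
  | r2 i j h f =>
    have : ((r2 i j h f).result x).size = x.size := by
      rw [size, result_edgeSet hr]
      obtain ⟨h1, h2, h3, h4, h5, h6, h7⟩ := hr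
      have hij := h1.ne
      have hfh : f ≠ h := fun e => h4 (e ▸ h5)
      have := h2.ne
      have := h5.ne
      rw [Set.ncard_union_eq, Set.ncard_sdiff, removed, added, Set.ncard_pair, Set.ncard_pair]
      · have : 2 ≤ x.size := by
          rw [← Set.ncard_pair (a := s(i, h)) (b := s(j, f))]
          · exact Set.ncard_le_ncard (by rintro _ (rfl | rfl) <;> assumption) (Set.toFinite _)
          · simp; tauto
        rw [size] at this ⊢
        omega
      · simp; tauto
      · simp; tauto
      · rintro _ (rfl | rfl) <;> assumption
      · rw [Set.disjoint_right]
        rintro _ (rfl | rfl) hm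
        exacts [h7 hm.1, h4 hm.1]
    rw [this]; rfl
  | r3 i j h =>
    have h1 := upd i ((r3 i j h).result x).flag fun v hv => by
      simp [result, newFlag, hv]
    have h2 : ((r3 i j h).result x).flag i = 0 := by simp [result, newFlag]
    have h3 := size_r3 hr
    rw [h2, hr.2.2.2.2, ← flagSum] at h1
    simp only [Fin.val_zero, Fin.val_one] at h1
    omega
  | r4 i j =>
    have : ((r4 i j).result x).size = x.size := by
      rw [size, result_edgeSet hr]
      simp [removed, added, size]
    rw [this]
    congr 1
    simp only [flagSum, result, newFlag, Function.comp]
    exact (Equiv.sum_comp _ (fun v => (x.flag v : ℕ))).symm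

lemma Reach.connected {V : Type*} [Fintype V] {x y : LabeledGraph V} (h : Reach x y)
    (hx : x.graph.Connected) : y.graph.Connected := by
  induction h with
  | refl => exact hx
  | tail _ h ih => exact h.connected ih

lemma Reach.size_add_flagSum {V : Type*} [Fintype V] {x y : LabeledGraph V} (h : Reach x y) :
    y.size + x.flagSum = x.size + y.flagSum := by
  induction h with
  | refl => rfl
  | tail _ h ih => have := h.size_add_flagSum; omega

end LabeledGraph

/-! ### Hitting sets in finite Markov chains -/

/-- The probability that a Markov chain with transition probabilities `P` started at `x` avoids `A`
up to time `n`. -/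
noncomputable def avoidProb {S : Type*} (P : S → PMF S) (A : Set S) : ℕ → S → ENNReal
  | 0, x => Aᶜ.indicator (fun _ => 1) x
  | n + 1, x => Aᶜ.indicator (fun x => ∑' y, P x y * avoidProb P A n y) x

section avoidProb

variable {S : Type*} {P : S → PMF S} {A : Set S}

lemma avoidProb_of_mem {x : S} (hx : x ∈ A) (n : ℕ) : avoidProb P A n x = 0 := by
  cases n <;> simp [avoidProb, hx]

lemma avoidProb_succ_of_notMem {x : S} (hx : x ∉ A) (n : ℕ) :
    avoidProb P A (n + 1) x = ∑' y, P x y * avoidProb P A n y := by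
  simp [avoidProb, hx]

lemma avoidProb_zero_of_notMem {x : S} (hx : x ∉ A) : avoidProb P A 0 x = 1 := by
  simp [avoidProb, hx]

lemma avoidProb_succ_le (n : ℕ) (x : S) : avoidProb P A (n + 1) x ≤ avoidProb P A n x := by
  induction n generalizing x with
  | zero =>
    by_cases hx : x ∈ A
    · simp [avoidProb_of_mem hx]
    · rw [avoidProb_succ_of_notMem hx, avoidProb_zero_of_notMem hx, ← (P x).tsum_coe]
      refine ENNReal.tsum_le_tsum fun y => mul_le_of_le_one_right' ?_
      by_cases hy : y ∈ A <;> simp [avoidProb, hy]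
  | succ n ih =>
    by_cases hx : x ∈ A
    · simp [avoidProb_of_mem hx]
    · rw [avoidProb_succ_of_notMem hx, avoidProb_succ_of_notMem hx]
      exact ENNReal.tsum_le_tsum fun y => by gcongr; exact ih y

lemma avoidProb_antitone (x : S) : Antitone fun n => avoidProb P A n x :=
  antitone_nat_of_succ_le fun n => avoidProb_succ_le n x

lemma avoidProb_le_one (n : ℕ) (x : S) : avoidProb P A n x ≤ 1 := by
  refine (avoidProb_antitone x (Nat.zero_le n)).trans ?_
  by_cases hx : x ∈ A <;> simp [avoidProb, hx]

lemma exists_avoidProb_lt_one {x z : S}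
    (h : Relation.ReflTransGen (fun x y => P x y ≠ 0) x z) (hz : z ∈ A) :
    ∃ n, avoidProb P A n x < 1 := by
  induction h using Relation.ReflTransGen.head_induction_on with
  | refl => exact ⟨0, by simp [avoidProb_of_mem hz]⟩
  | @head x y hxy _ ih =>
    obtain ⟨n, hn⟩ := ih
    by_cases hx : x ∈ A
    · exact ⟨0, by simp [avoidProb_of_mem hx]⟩
    · refine ⟨n + 1, ?_⟩
      rw [avoidProb_succ_of_notMem hx]
      have hle : ∀ y, P x y * avoidProb P A n y ≤ P x y :=
        fun y => mul_le_of_le_one_right' (avoidProb_le_one n y)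
      calc ∑' y, P x y * avoidProb P A n y < ∑' y, P x y := by
            refine ENNReal.tsum_lt_tsum (i := y) ?_ hle ?_
            · refine ne_top_of_le_ne_top ENNReal.one_ne_top ?_
              rw [← (P x).tsum_coe]
              exact ENNReal.tsum_le_tsum hle
            · calc P x y * avoidProb P A n y < P x y * 1 :=
                    (ENNReal.mul_lt_mul_iff_right hxy ((P x).apply_ne_top y)).2 hn
                _ = P x y := mul_one _
        _ = 1 := (P x).tsum_coe

/-- After `n` steps the chain is still in the closed set `R`, so avoiding `A` for `N` further steps
costs another factor `ρ`. -/
lemma avoidProb_add_le {R : Set S} (hR : ∀ x ∈ R, ∀ y, P x y ≠ 0 → y ∈ R) {ρ : ENNReal} {N : ℕ}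
    (hN : ∀ x ∈ R, avoidProb P A N x ≤ ρ) (n : ℕ) {x : S} (hx : x ∈ R) :
    avoidProb P A (N + n) x ≤ ρ * avoidProb P A n x := by
  induction n generalizing x with
  | zero =>
    by_cases hxA : x ∈ A
    · simp [avoidProb_of_mem hxA]
    · simpa [avoidProb_zero_of_notMem hxA] using hN x hx
  | succ n ih =>
    by_cases hxA : x ∈ A
    · simp [avoidProb_of_mem hxA]
    · rw [← add_assoc, avoidProb_succ_of_notMem hxA, avoidProb_succ_of_notMem hxA,
        ← ENNReal.tsum_mul_left]
      refine ENNReal.tsum_le_tsum fun y => ?_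
      by_cases hy : P x y = 0
      · simp [hy]
      · calc P x y * avoidProb P A (N + n) y ≤ P x y * (ρ * avoidProb P A n y) := by
              gcongr; exact ih (hR x hx y hy)
          _ = ρ * (P x y * avoidProb P A n y) := by ring

/-- Finiteness gives one horizon `N` and one bound below 1 for all starting states in `R`; iterating
over blocks of `N` steps gives geometric decay. -/
lemma iInf_avoidProb_eq_zero [Finite S] {R : Set S} (hR : ∀ x ∈ R, ∀ y, P x y ≠ 0 → y ∈ R)
    (hA : ∀ x ∈ R, ∃ z ∈ A, Relation.ReflTransGen (fun x y => P x y ≠ 0) x z) {x : S}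
    (hx : x ∈ R) : ⨅ n, avoidProb P A n x = 0 := by
  have h1 : ∀ x : S, ∃ n, x ∈ R → avoidProb P A n x < 1 := by
    intro x
    by_cases hx : x ∈ R
    · obtain ⟨z, hz, hxz⟩ := hA x hx
      obtain ⟨n, hn⟩ := exists_avoidProb_lt_one hxz hz
      exact ⟨n, fun _ => hn⟩
    · exact ⟨0, fun h => absurd h hx⟩
  choose n hn using h1
  obtain ⟨N, hN⟩ := (Set.finite_range n).bddAbove
  have hlt : ∀ x ∈ R, avoidProb P A N x < 1 := fun x hx =>
    (avoidProb_antitone x (hN ⟨x, rfl⟩)).trans_lt (hn x hx)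
  obtain ⟨x₁, hx₁, hmax⟩ := R.toFinite.exists_maximalFor (avoidProb P A N) R ⟨x, hx⟩
  have hle : ∀ x ∈ R, avoidProb P A N x ≤ avoidProb P A N x₁ := fun y hy =>
    (le_total _ _).elim id fun h => hmax hy h
  have hpow : ∀ k : ℕ, avoidProb P A (N * k) x ≤ avoidProb P A N x₁ ^ k := by
    intro k
    induction k with
    | zero => simpa using avoidProb_le_one 0 x
    | succ k ih =>
      rw [Nat.mul_succ, add_comm, pow_succ']
      exact (avoidProb_add_le hR hle _ hx).trans (by gcongr)
  refine le_antisymm (ge_of_tendsto' (ENNReal.tendsto_pow_atTop_nhds_zero_of_lt_one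
    (hlt x₁ hx₁)) fun k => ?_) zero_le
  exact (iInf_le _ (N * k)).trans (hpow k)

end avoidProb

namespace IsMarkovChain

open MeasureTheory

variable {Ω S : Type*} [MeasurableSpace Ω] {μ : Measure Ω} {X : ℕ → Ω → S} {x₀ : S}
  {P : S → PMF S}

/-- Induction on `n`, splitting on the state at time `t + 1`. Only an upper bound is needed, so
countable subadditivity suffices. -/
lemma measure_cylinder_inter_avoid_le [Countable S] (hX : IsMarkovChain μ X x₀ P) (A : Set S)
    (n t : ℕ) (x : ℕ → S) :
    μ ({ω | ∀ s ≤ t, X s ω = x s} ∩ {ω | ∀ s, t ≤ s → s ≤ t + n → X s ω ∉ A}) ≤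
      μ {ω | ∀ s ≤ t, X s ω = x s} * avoidProb P A n (x t) := by
  classical
  by_cases hx : x t ∈ A
  · rw [avoidProb_of_mem hx, mul_zero, nonpos_iff_eq_zero]
    convert measure_empty (μ := μ)
    ext ω
    simp only [Set.mem_inter_iff, Set.mem_ofPred_eq, Set.mem_empty_iff_false, iff_false]
    rintro ⟨h1, h2⟩
    exact h2 t le_rfl (by omega) (h1 t le_rfl ▸ hx)
  · induction n generalizing t x with
    | zero =>
      rw [avoidProb_zero_of_notMem hx, mul_one]
      exact measure_mono Set.inter_subset_left
    | succ n ih =>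
      rw [avoidProb_succ_of_notMem hx, ← ENNReal.tsum_mul_left]
      have hsub : {ω | ∀ s ≤ t, X s ω = x s} ∩ {ω | ∀ s, t ≤ s → s ≤ t + (n + 1) → X s ω ∉ A} ⊆
          ⋃ y, ({ω | ∀ s ≤ t + 1, X s ω = Function.update x (t + 1) y s} ∩
            {ω | ∀ s, t + 1 ≤ s → s ≤ t + 1 + n → X s ω ∉ A}) := by
        rintro ω ⟨h1, h2⟩
        refine Set.mem_iUnion.2 ⟨X (t + 1) ω, fun s hs => ?_, fun s hs hs' =>
          h2 s (by omega) (by omega)⟩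
        rcases eq_or_ne s (t + 1) with rfl | hne
        · simp
        · rw [Function.update_of_ne hne]; exact h1 s (by omega)
      refine (measure_mono hsub).trans ((measure_iUnion_le _).trans
        (ENNReal.tsum_le_tsum fun y => ?_))
      have hcyl : μ {ω | ∀ s ≤ t + 1, X s ω = Function.update x (t + 1) y s} =
          μ {ω | ∀ s ≤ t, X s ω = x s} * P (x t) y := by
        rw [hX.step, Function.update_self, Function.update_of_ne (by omega)]
        congr 2
        ext ω
        refine forall₂_congr fun s hs => ?_
        rw [Function.update_of_ne (by omega)]
      by_cases hy : y ∈ A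
      · rw [avoidProb_of_mem hy, mul_zero, mul_zero, nonpos_iff_eq_zero]
        convert measure_empty (μ := μ)
        ext ω
        simp only [Set.mem_inter_iff, Set.mem_ofPred_eq, Set.mem_empty_iff_false, iff_false]
        rintro ⟨h1, h2⟩
        refine h2 (t + 1) le_rfl (by omega) ?_
        rw [h1 (t + 1) le_rfl, Function.update_self]
        exact hy
      · refine (ih (t + 1) (Function.update x (t + 1) y) (by simpa using hy)).trans ?_
        rw [hcyl, Function.update_self, mul_assoc]

/-- A Markov chain on a finite state space almost surely visits a set that is accessible from every
state of a closed set containing the initial state. -/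
theorem ae_exists_mem [Finite S] [IsProbabilityMeasure μ] (hX : IsMarkovChain μ X x₀ P)
    {A R : Set S} (hx₀ : x₀ ∈ R) (hR : ∀ x ∈ R, ∀ y, P x y ≠ 0 → y ∈ R)
    (hA : ∀ x ∈ R, ∃ z ∈ A, Relation.ReflTransGen (fun x y => P x y ≠ 0) x z) :
    ∀ᵐ ω ∂μ, ∃ t, X t ω ∈ A := by
  have h : ∀ n, μ {ω | ¬ ∃ t, X t ω ∈ A} ≤ avoidProb P A n x₀ := by
    intro n
    have h1 := hX.measure_cylinder_inter_avoid_le A n 0 fun _ => x₀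
    refine le_trans ?_ (h1.trans (mul_le_of_le_one_left' prob_le_one))
    refine measure_mono_ae ?_
    filter_upwards [hX.init] with ω hω hnot
    refine ⟨fun s hs => ?_, fun s _ _ hs => hnot ⟨s, hs⟩⟩
    rw [Nat.le_zero.1 hs, hω]
  rw [ae_iff, ← nonpos_iff_eq_zero, ← iInf_avoidProb_eq_zero hR hA hx₀]
  exact le_iInf h

end IsMarkovChain

/-! ### Degree changes under rewiring -/

namespace LabeledGraph

open RuleInstance

lemma exists_adj_notMem {V : Type*} [Fintype V] {x : LabeledGraph V} {v : V} (F : Finset V)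
    (h : F.card < x.deg v) : ∃ u, x.graph.Adj v u ∧ u ∉ F := by
  by_contra! hc
  rw [deg_eq_ncard, ← Set.ncard_coe_finset] at h
  exact h.not_ge (Set.ncard_le_ncard (fun u hu => hc u hu) F.finite_toSet)

/-- Otherwise all neighbors of `i` except `j` would be neighbors of `j` other than `i`, forcing
`x.deg i ≤ x.deg j`. This supplies the third node for both forms of the first rule. -/
lemma exists_adj_not_adj {V : Type*} [Fintype V] {x : LabeledGraph V} {i j : V}
    (hij : x.graph.Adj i j) (h : x.deg j < x.deg i) :
    ∃ k, x.graph.Adj i k ∧ k ≠ j ∧ ¬ x.graph.Adj j k := by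
  by_contra! hc
  have hsub : x.graph.neighborSet i ⊆ insert j (x.graph.neighborSet j \ {i}) := fun u hu => by
    by_cases hj : u = j
    · exact Or.inl hj
    · exact Or.inr ⟨hc u hu hj, hu.ne'⟩
  have h1 := Set.ncard_le_ncard hsub (Set.toFinite _)
  have h2 := Set.ncard_insert_le j (x.graph.neighborSet j \ {i})
  have h3 : (x.graph.neighborSet j \ {i}).ncard + 1 = (x.graph.neighborSet j).ncard :=
    Set.ncard_sdiff_singleton_add_one hij.symm (Set.toFinite _)
  rw [deg_eq_ncard, deg_eq_ncard] at h
  omega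

section Rewire

lemma adj_r1Rewire {V : Type*} {x : LabeledGraph V} {i j k u v : V}
    (huv : x.graph.Adj u v) (h : s(u, v) ≠ s(i, k)) :
    ((r1Rewire i j k).result x).graph.Adj u v :=
  (result_adj _ _ _ _).2 ⟨Or.inl ⟨huv, h⟩, huv.ne⟩

variable {V : Type*} [Fintype V] {x : LabeledGraph V} {i j k : V}

lemma deg_r1Rewire_left (hr : (r1Rewire i j k).Applicable x) :
    ((r1Rewire i j k).result x).deg i + 1 = x.deg i := by
  obtain ⟨h1, h2, h3, h4, h5⟩ := hr
  rw [deg_eq_ncard, deg_eq_ncard]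
  convert Set.ncard_sdiff_singleton_add_one (s := x.graph.neighborSet i) (a := k) h3
    (Set.toFinite _) using 3
  ext u
  have := h1.ne
  have := h3.ne
  simp only [SimpleGraph.mem_neighborSet, result_adj, removed, added, Set.mem_singleton_iff,
    Sym2.eq_iff, Set.mem_sdiff]
  have := @SimpleGraph.Adj.ne _ x.graph i u
  aesop

lemma deg_r1Rewire_right (hr : (r1Rewire i j k).Applicable x) :
    ((r1Rewire i j k).result x).deg j = x.deg j + 1 := by
  obtain ⟨h1, h2, h3, h4, h5⟩ := hr
  rw [deg_eq_ncard, deg_eq_ncard]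
  convert Set.ncard_insert_of_notMem (s := x.graph.neighborSet j) (a := k) h5
    (Set.toFinite _) using 2
  ext u
  have := h1.ne
  have := h3.ne
  simp only [SimpleGraph.mem_neighborSet, result_adj, removed, added, Set.mem_singleton_iff,
    Sym2.eq_iff, Set.mem_insert_iff]
  have := @SimpleGraph.Adj.ne _ x.graph j u
  aesop

lemma deg_r1Rewire_of_ne (hr : (r1Rewire i j k).Applicable x) {v : V} (hi : v ≠ i) (hj : v ≠ j) :
    ((r1Rewire i j k).result x).deg v = x.deg v := by
  obtain ⟨h1, h2, h3, h4, h5⟩ := hr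
  by_cases hk : v = k
  · subst hk
    rw [deg_eq_ncard, deg_eq_ncard, ← Set.ncard_sdiff_singleton_add_one
      (s := x.graph.neighborSet v) (a := i) h3.symm (Set.toFinite _),
      ← Set.ncard_insert_of_notMem (s := x.graph.neighborSet v \ {i}) (a := j)
        (fun h => h5 h.1.symm) (Set.toFinite _)]
    congr 1
    ext u
    simp only [SimpleGraph.mem_neighborSet, result_adj, removed, added, Set.mem_singleton_iff,
      Sym2.eq_iff, Set.mem_insert_iff, Set.mem_sdiff]
    have := @SimpleGraph.Adj.ne _ x.graph v u
    aesop
  · exact deg_result_of_notMem (by simp [nodes, hi, hj, hk])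

lemma deg_r2 {i j k f : V} (hr : (r2 i j k f).Applicable x) (v : V) :
    ((r2 i j k f).result x).deg v = x.deg v := by
  obtain ⟨h1, h2, h3, h4, h5, h6, h7⟩ := hr
  have hfk : f ≠ k := fun e => h4 (e ▸ h5)
  have key : ∀ v a b : V, x.graph.Adj v a → ¬ x.graph.Adj v b →
      (∀ u, ((r2 i j k f).result x).graph.Adj v u ↔ u = b ∨ (x.graph.Adj v u ∧ u ≠ a)) →
      ((r2 i j k f).result x).deg v = x.deg v := by
    intro v a b ha hb hadj
    rw [deg_eq_ncard, deg_eq_ncard, ← Set.ncard_sdiff_singleton_add_one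
      (s := x.graph.neighborSet v) (a := a) ha (Set.toFinite _),
      ← Set.ncard_insert_of_notMem (s := x.graph.neighborSet v \ {a}) (a := b)
        (fun h => hb h.1) (Set.toFinite _)]
    congr 1
    ext u
    exact hadj u
  have hij := h1.ne
  have hik := h2.ne
  have hjf := h5.ne
  by_cases hv : v ∈ (r2 i j k f).nodes
  · have hvu := @SimpleGraph.Adj.ne _ x.graph v
    rcases hv with rfl | rfl | rfl | rfl
    · refine key _ k f h2 h7 fun u => ?_
      simp only [result_adj, removed, added, Set.mem_insert_iff, Set.mem_singleton_iff,
        Sym2.eq_iff]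
      have := @hvu u
      aesop
    · refine key _ f k h5 h4 fun u => ?_
      simp only [result_adj, removed, added, Set.mem_insert_iff, Set.mem_singleton_iff,
        Sym2.eq_iff]
      have := @hvu u
      aesop
    · refine key _ i j h2.symm (fun h => h4 h.symm) fun u => ?_
      simp only [result_adj, removed, added, Set.mem_insert_iff, Set.mem_singleton_iff,
        Sym2.eq_iff]
      have := @hvu u
      aesop
    · refine key _ j i h5.symm (fun h => h7 h.symm) fun u => ?_
      simp only [result_adj, removed, added, Set.mem_insert_iff, Set.mem_singleton_iff,
        Sym2.eq_iff]
      have := @hvu u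
      aesop
  · exact deg_result_of_notMem hv

end Rewire

/-- `y` is reachable from `x` and carries the same flags. -/
def Rearranges {V : Type*} [Fintype V] (x y : LabeledGraph V) : Prop :=
  Reach x y ∧ y.flag = x.flag

section Rearranges

variable {V : Type*} [Fintype V] {x y z : LabeledGraph V}

lemma Rearranges.refl (x : LabeledGraph V) : Rearranges x x := ⟨.refl, rfl⟩

lemma Rearranges.trans (h : Rearranges x y) (h' : Rearranges y z) : Rearranges x z :=
  ⟨h.1.trans h'.1, h'.2.trans h.2⟩

lemma Rearranges.size_eq (h : Rearranges x y) : y.size = x.size := by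
  have h1 := h.1.size_add_flagSum
  have h2 : y.flagSum = x.flagSum := by rw [flagSum, flagSum, h.2]
  omega

lemma rearranges_r1Rewire {i j k : V} (h : (r1Rewire i j k).Applicable x) :
    Rearranges x ((r1Rewire i j k).result x) :=
  ⟨.single ⟨_, h, rfl⟩, rfl⟩

lemma rearranges_r2 {i j k f : V} (h : (r2 i j k f).Applicable x) :
    Rearranges x ((r2 i j k f).result x) :=
  ⟨.single ⟨_, h, rfl⟩, rfl⟩

end Rearranges

/-! ### Balancing the degrees -/

lemma sum_sq_r1Rewire {V : Type*} [Fintype V] {x : LabeledGraph V} {i j k : V}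
    (hr : (r1Rewire i j k).Applicable x) :
    ∑ v, ((r1Rewire i j k).result x).deg v ^ 2 + 2 * x.deg i =
      ∑ v, x.deg v ^ 2 + 2 * x.deg j + 2 := by
  classical
  have hj : j ∈ Finset.univ.erase i := by simp [hr.1.ne']
  have split : ∀ f : V → ℕ, ∑ v, f v = f i + (f j + ∑ v ∈ (Finset.univ.erase i).erase j, f v) :=
    fun f => by rw [Finset.add_sum_erase _ _ hj, Finset.add_sum_erase _ _ (Finset.mem_univ i)]
  rw [split, split fun v => x.deg v ^ 2, Finset.sum_congr rfl (g := fun v => x.deg v ^ 2)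
    fun v hv => by
      simp only [Finset.mem_erase, Finset.mem_univ, and_true] at hv
      rw [deg_r1Rewire_of_ne hr hv.2 hv.1]]
  rw [deg_r1Rewire_right hr, ← deg_r1Rewire_left hr]
  ring

/-- The surplus at `u` is pushed along the path towards `v` until it meets a drop of at least two
across one edge, where rewiring is a strict gain. -/
lemma exists_rearranges_sum_sq_lt {V : Type*} [Fintype V] (n : ℕ) (x : LabeledGraph V) (u v : V)
    (p : x.graph.Walk u v) (hp : p.IsPath) (hn : p.length = n) (h : x.deg v + 2 ≤ x.deg u) :
    ∃ y, Rearranges x y ∧ ∑ v, y.deg v ^ 2 < ∑ v, x.deg v ^ 2 := by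
  induction n generalizing x u v with
  | zero =>
    obtain rfl := SimpleGraph.Walk.eq_of_length_eq_zero hn
    omega
  | succ n ih =>
    cases p with
    | nil => simp at hn
    | @cons _ w _ huw p =>
      rw [SimpleGraph.Walk.cons_isPath_iff] at hp
      rw [SimpleGraph.Walk.length_cons, Nat.add_right_cancel_iff] at hn
      by_cases hvw : x.deg v + 2 ≤ x.deg w
      · exact ih x w v p hp.1 hn hvw
      obtain ⟨k, hk⟩ := exists_adj_not_adj huw (by omega)
      have hr : (r1Rewire u w k).Applicable x := ⟨huw, by omega, hk⟩
      have hsq := sum_sq_r1Rewire hr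
      by_cases huw2 : x.deg w + 2 ≤ x.deg u
      · exact ⟨_, rearranges_r1Rewire hr, by omega⟩
      -- What remains is `x.deg u = x.deg w + 1` and `x.deg w = x.deg v + 1`: rewiring exchanges the
      -- degrees of `u` and `w` at no cost. The rest of the path avoids `u`, so it survives.
      have hedge : ∀ e ∈ p.edges, e ∈ ((r1Rewire u w k).result x).graph.edgeSet := by
        intro e he
        induction e with
        | h a b =>
          refine adj_r1Rewire (p.adj_of_mem_edges he) fun heq => hp.2 ?_
          rw [heq] at he
          exact p.fst_mem_support_of_mem_edges he
      have hdv := deg_r1Rewire_of_ne hr (v := v) (fun e => by subst e; omega)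
        (fun e => by subst e; omega)
      have hdw := deg_r1Rewire_right hr
      obtain ⟨y, hy, hlt⟩ := ih _ w v (p.transfer _ hedge) (hp.1.transfer hedge)
        (by simpa using hn) (by omega)
      exact ⟨y, (rearranges_r1Rewire hr).trans hy, by omega⟩

lemma exists_rearranges_balanced {V : Type*} [Fintype V] (x : LabeledGraph V)
    (hx : x.graph.Connected) : ∃ y, Rearranges x y ∧ ∀ u v, y.deg u ≤ y.deg v + 1 := by
  induction hN : ∑ v, x.deg v ^ 2 using Nat.strong_induction_on generalizing x with
  | _ N ih =>
    subst hN
    by_cases h : ∀ u v, x.deg u ≤ x.deg v + 1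
    · exact ⟨x, .refl x, h⟩
    push Not at h
    obtain ⟨u, v, h⟩ := h
    obtain ⟨p, hp⟩ := (hx.preconnected u v).exists_isPath
    obtain ⟨y, hy, hlt⟩ := exists_rearranges_sum_sq_lt _ x u v p hp rfl h
    obtain ⟨z, hz, hbal⟩ := ih _ hlt y (hy.1.connected hx) rfl
    exact ⟨z, hy.trans hz, hbal⟩

/-! ### Transporting flags and adding an edge -/

lemma exists_reach_flag_eq {V : Type*} [Fintype V] {G : SimpleGraph V} {u v : V} (p : G.Walk u v)
    (x : LabeledGraph V) (hx : x.graph = G) :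
    ∃ y, Reach x y ∧ y.graph = G ∧ y.flag v = x.flag u := by
  induction p generalizing x with
  | nil => exact ⟨x, .refl, hx, rfl⟩
  | @cons u w v huw p ih =>
    have hr : (r4 u w).Applicable x := by subst hx; exact huw
    obtain ⟨y, h1, h2, h3⟩ := ih ((r4 u w).result x) (by simp [result, removed, added, hx])
    exact ⟨y, h1.head ⟨_, hr, rfl⟩, h2, by simpa [result, newFlag] using h3⟩

lemma exists_adj_deg_lt {V : Type*} [Fintype V] {x : LabeledGraph V} (hx : x.graph.Connected)
    (hreg : ∀ m, ¬ x.IsRegular m) : ∃ i j, x.graph.Adj i j ∧ x.deg j < x.deg i := by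
  by_contra! hc
  obtain ⟨v⟩ := hx.nonempty
  refine hreg (x.deg v) fun u => ?_
  obtain ⟨p⟩ := hx.preconnected u v
  induction p with
  | nil => rfl
  | cons h p ih => exact ((hc _ _ h).antisymm (hc _ _ h.symm)).trans ih

lemma exists_reach_size_succ {V : Type*} [Fintype V] {x : LabeledGraph V}
    (hx : x.graph.Connected) (hreg : ∀ m, ¬ x.IsRegular m) {v : V} (hv : x.flag v = 0) :
    ∃ y, Reach x y ∧ y.size = x.size + 1 := by
  obtain ⟨i, j, hij, hd⟩ := exists_adj_deg_lt hx hreg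
  obtain ⟨p⟩ := hx.preconnected v i
  obtain ⟨y, hy, hg, hf⟩ := exists_reach_flag_eq p x rfl
  obtain ⟨k, hk1, hk2, hk3⟩ := exists_adj_not_adj hij hd
  have hr : (r1Add i j k).Applicable y := by
    simp only [Applicable, deg_eq_ncard, hg, hf, hv] at hd ⊢
    exact ⟨hij, hd, hk1, hk2, hk3, trivial⟩
  refine ⟨_, hy.tail ⟨_, hr, rfl⟩, ?_⟩
  rw [size_r1Add hr, size, size, hg]

/-! ### Uneven triangles and removing an edge -/

/-- There is a triangle whose nodes do not all have the same degree. -/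
def HasUnevenTriangle {V : Type*} [Fintype V] (x : LabeledGraph V) : Prop :=
  ∃ a b c, x.graph.Adj a b ∧ x.graph.Adj a c ∧ x.graph.Adj b c ∧ x.deg b < x.deg a

lemma HasUnevenTriangle.of_ne {V : Type*} [Fintype V] {x : LabeledGraph V} {a b c : V}
    (hab : x.graph.Adj a b) (hac : x.graph.Adj a c) (hbc : x.graph.Adj b c)
    (h : x.deg a ≠ x.deg b) : x.HasUnevenTriangle := by
  rcases h.lt_or_gt with h | h
  · exact ⟨b, a, c, hab.symm, hbc, hac, h⟩
  · exact ⟨a, b, c, hab, hac, hbc, h⟩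

lemma HasUnevenTriangle.exists_reach_size_pred {V : Type*} [Fintype V] {x : LabeledGraph V}
    (h : x.HasUnevenTriangle) (hx : x.graph.Connected) {v : V} (hv : x.flag v = 1) :
    ∃ y, Reach x y ∧ y.size + 1 = x.size := by
  obtain ⟨a, b, c, hab, hac, hbc, hd⟩ := h
  obtain ⟨p⟩ := hx.preconnected v a
  obtain ⟨y, hy, hg, hf⟩ := exists_reach_flag_eq p x rfl
  have hr : (r3 a b c).Applicable y := by
    simp only [Applicable, deg_eq_ncard, hg, hf, hv] at hd ⊢
    exact ⟨hab, hd, hac, hbc, trivial⟩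
  refine ⟨_, hy.tail ⟨_, hr, rfl⟩, ?_⟩
  rw [size_r3 hr, size, size, hg]

/-- The nodes `a`, `b`, `c` form a triangle. -/
def IsTriangle {V : Type*} (x : LabeledGraph V) (a b c : V) : Prop :=
  x.graph.Adj a b ∧ x.graph.Adj a c ∧ x.graph.Adj b c

lemma IsTriangle.r1Rewire {V : Type*} [Fintype V] {x : LabeledGraph V} {a b c : V}
    (h : x.IsTriangle a b c) {i j k : V} (ha : a ≠ i) (hb : b ≠ i) (hc : c ≠ i) :
    ((RuleInstance.r1Rewire i j k).result x).IsTriangle a b c := by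
  obtain ⟨h1, h2, h3⟩ := h
  refine ⟨adj_r1Rewire h1 ?_, adj_r1Rewire h2 ?_, adj_r1Rewire h3 ?_⟩ <;> simp [ha, hb, hc]

lemma IsTriangle.exists_hasUnevenTriangle_of_adj {V : Type*} [Fintype V] {x : LabeledGraph V}
    {a b c u : V} {d k : ℕ} (h : x.IsTriangle a b c) (ha : x.deg a = d) (hb : x.deg b = d)
    (hc : x.deg c = d) (hua : x.graph.Adj u a) (hu : x.deg u ≠ d) (hk : 3 ≤ k)
    (hdeg : ∀ v, k ≤ x.deg v ∧ x.deg v ≤ k + 1) :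
    ∃ y, Rearranges x y ∧ y.HasUnevenTriangle := by
  classical
  have hua' : u ≠ a := hua.ne
  have hub : u ≠ b := fun e => hu (e ▸ hb)
  have huc : u ≠ c := fun e => hu (e ▸ hc)
  have hab := h.1.ne
  have := hdeg u
  have := hdeg a
  rcases hu.lt_or_gt with hlt | hlt
  -- Here `x.deg a = k + 1 ≥ 4`, so `a` has a neighbor outside the triangle and different from `u`.
  -- Handing it to `u` lowers only the degree of `a` within the triangle.
  · obtain ⟨q, hq, hqF⟩ := exists_adj_notMem (x := x) (v := a) {b, c, u}
      (Finset.card_le_three.trans_lt (by omega))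
    simp only [Finset.mem_insert, Finset.mem_singleton, not_or] at hqF
    by_cases hqu : x.graph.Adj u q
    · exact ⟨x, .refl x, .of_ne hua hqu hq (ha ▸ hu)⟩
    have hr : (RuleInstance.r1Rewire a u q).Applicable x :=
      ⟨hua.symm, by omega, hq, hqF.2.2, hqu⟩
    refine ⟨_, rearranges_r1Rewire hr, .of_ne (a := a) (b := b) (c := c) (adj_r1Rewire h.1 ?_)
      (adj_r1Rewire h.2.1 ?_) (adj_r1Rewire h.2.2 ?_) ?_⟩
    · simp [Ne.symm hqF.1, hab.symm]
    · simp [Ne.symm hqF.2.1, h.2.1.ne']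
    · simp [hab.symm, h.2.1.ne']
    · have := deg_r1Rewire_left hr
      rw [deg_r1Rewire_of_ne hr hab.symm hub.symm]
      omega
  · obtain ⟨q, hq⟩ := exists_adj_not_adj hua (by omega)
    have hr : (RuleInstance.r1Rewire u a q).Applicable x := ⟨hua, by omega, hq⟩
    obtain ⟨h1, h2, h3⟩ := h.r1Rewire (j := a) (k := q) hua'.symm hub.symm huc.symm
    refine ⟨_, rearranges_r1Rewire hr, .of_ne h1 h2 h3 ?_⟩
    rw [deg_r1Rewire_right hr, deg_r1Rewire_of_ne hr hub.symm hab.symm]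
    omega

/-- With only two degree values, rewiring across an edge with unequal degrees swaps them. The
deviating degree thus travels along the path to a neighbor of the triangle, unless an uneven
triangle turns up on the way. -/
lemma IsTriangle.exists_hasUnevenTriangle {V : Type*} [Fintype V] (n : ℕ) (x : LabeledGraph V)
    {a b c u : V} {d k : ℕ} (p : x.graph.Walk u a) (hp : p.IsPath) (hn : p.length = n)
    (h : x.IsTriangle a b c) (ha : x.deg a = d) (hb : x.deg b = d) (hc : x.deg c = d)
    (hu : x.deg u ≠ d) (hk : 3 ≤ k) (hdeg : ∀ v, k ≤ x.deg v ∧ x.deg v ≤ k + 1) :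
    ∃ y, Rearranges x y ∧ y.HasUnevenTriangle := by
  classical
  induction n generalizing x u with
  | zero =>
    obtain rfl := SimpleGraph.Walk.eq_of_length_eq_zero hn
    exact absurd ha hu
  | succ n ih =>
    cases p with
    | nil => simp at hn
    | @cons _ v _ huv p =>
      rw [SimpleGraph.Walk.cons_isPath_iff] at hp
      rw [SimpleGraph.Walk.length_cons, Nat.add_right_cancel_iff] at hn
      by_cases hv : x.deg v ≠ d
      · exact ih x p hp.1 hn h ha hb hc hv hdeg
      push Not at hv
      by_cases hva : v = a
      · subst hva
        exact h.exists_hasUnevenTriangle_of_adj ha hb hc huv hu hk hdeg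
      by_cases hvb : v = b
      · subst hvb
        exact IsTriangle.exists_hasUnevenTriangle_of_adj ⟨h.1.symm, h.2.2, h.2.1⟩ hb ha hc huv hu
          hk hdeg
      by_cases hvc : v = c
      · subst hvc
        exact IsTriangle.exists_hasUnevenTriangle_of_adj ⟨h.2.1.symm, h.2.2.symm, h.1⟩ hc ha hb
          huv hu hk hdeg
      have hau : a ≠ u := fun e => hu (e ▸ ha)
      have hbu : b ≠ u := fun e => hu (e ▸ hb)
      have hcu : c ≠ u := fun e => hu (e ▸ hc)
      have hdu := hdeg u
      have hdv := hdeg v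
      rcases hu.lt_or_gt with hlt | hlt
      · cases p with
        | nil => exact absurd rfl hva
        | @cons _ w _ hvw p' =>
          -- The edge taken from `v` must not be the path edge `vw`, hence `w` is excluded.
          obtain ⟨q, hq, hqF⟩ := exists_adj_notMem (x := x) (v := v) {u, w}
            (Finset.card_le_two.trans_lt (by omega))
          simp only [Finset.mem_insert, Finset.mem_singleton, not_or] at hqF
          by_cases hqu : x.graph.Adj u q
          · exact ⟨x, .refl x, .of_ne huv hqu hq (hv ▸ hu)⟩
          have hr : (RuleInstance.r1Rewire v u q).Applicable x :=
            ⟨huv.symm, by omega, hq, hqF.1, hqu⟩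
          have hedge : ∀ e ∈ (SimpleGraph.Walk.cons hvw p').edges,
              e ∈ ((RuleInstance.r1Rewire v u q).result x).graph.edgeSet := by
            intro e he
            induction e with
            | h s t =>
              refine adj_r1Rewire (SimpleGraph.Walk.adj_of_mem_edges _ he) fun heq => ?_
              rw [heq, SimpleGraph.Walk.edges_cons, List.mem_cons] at he
              rcases he with he | he
              · exact hqF.2 (Sym2.congr_right.1 he)
              · exact ((SimpleGraph.Walk.cons_isPath_iff _ _).1 hp.1).2
                  (p'.fst_mem_support_of_mem_edges he)
          have h1 := deg_r1Rewire_left hr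
          have h2 := deg_r1Rewire_right hr
          have h3 := @deg_r1Rewire_of_ne _ _ _ _ _ _ hr
          obtain ⟨y, hy, hy'⟩ := ih _ (SimpleGraph.Walk.transfer _ _ hedge) (hp.1.transfer hedge)
            (by rwa [SimpleGraph.Walk.length_transfer])
            (h.r1Rewire (Ne.symm hva) (Ne.symm hvb) (Ne.symm hvc))
            ((h3 (Ne.symm hva) hau).trans ha) ((h3 (Ne.symm hvb) hbu).trans hb)
            ((h3 (Ne.symm hvc) hcu).trans hc) (by omega) fun s => by
              by_cases hsv : s = v
              · subst hsv; omega
              by_cases hsu : s = u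
              · subst hsu; omega
              rw [h3 hsv hsu]
              exact hdeg s
          exact ⟨y, (rearranges_r1Rewire hr).trans hy, hy'⟩
      · obtain ⟨q, hq⟩ := exists_adj_not_adj huv (by omega)
        have hr : (RuleInstance.r1Rewire u v q).Applicable x := ⟨huv, by omega, hq⟩
        have hedge : ∀ e ∈ p.edges,
            e ∈ ((RuleInstance.r1Rewire u v q).result x).graph.edgeSet := by
          intro e he
          induction e with
          | h s t =>
            refine adj_r1Rewire (p.adj_of_mem_edges he) fun heq => hp.2 ?_
            rw [heq] at he
            exact p.fst_mem_support_of_mem_edges he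
        have h1 := deg_r1Rewire_left hr
        have h2 := deg_r1Rewire_right hr
        have h3 := @deg_r1Rewire_of_ne _ _ _ _ _ _ hr
        obtain ⟨y, hy, hy'⟩ := ih _ (p.transfer _ hedge) (hp.1.transfer hedge)
          (by simpa using hn) (h.r1Rewire hau hbu hcu)
          ((h3 hau (Ne.symm hva)).trans ha) ((h3 hbu (Ne.symm hvb)).trans hb)
          ((h3 hcu (Ne.symm hvc)).trans hc) (by omega) fun s => by
            by_cases hsv : s = v
            · subst hsv; omega
            by_cases hsu : s = u
            · subst hsu; omega
            rw [h3 hsu hsv]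
            exact hdeg s
        exact ⟨y, (rearranges_r1Rewire hr).trans hy, hy'⟩

/-! ### Creating a triangle -/

lemma exists_forall_mem_edges_eq {V : Type*} {G : SimpleGraph V} {s t : V} (p : G.Walk s t)
    (hp : p.IsPath) : ∃ w, ∀ u, s(t, u) ∈ p.edges → u = w := by
  have hp' := hp.reverse
  simp only [← List.mem_reverse (as := p.edges), ← SimpleGraph.Walk.edges_reverse]
  cases hq : p.reverse with
  | nil => exact ⟨s, fun u hu => by simp at hu⟩
  | @cons _ w _ h q =>
    rw [hq, SimpleGraph.Walk.cons_isPath_iff] at hp'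
    refine ⟨w, fun u hu => ?_⟩
    rw [SimpleGraph.Walk.edges_cons, List.mem_cons] at hu
    rcases hu with hu | hu
    · exact Sym2.congr_right.1 hu
    · exact absurd (q.fst_mem_support_of_mem_edges hu) hp'.2

/-- The path closes to a cycle through `t` and `v`. The second rule replaces `tq`, `vs` by `ts`,
`vq`, which cuts `v` out of the cycle and keeps all degrees. Degree 3 at `t` provides a `q` off the
cycle edges at `t`. -/
lemma exists_rearranges_isTriangle_of_path {V : Type*} [Fintype V] (n : ℕ) (x : LabeledGraph V)
    {s t v : V} (p : x.graph.Walk s t) (hp : p.IsPath) (hn : p.length = n)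
    (htv : x.graph.Adj t v) (hvs : x.graph.Adj v s) (hvp : v ∉ p.support) (hst : s ≠ t)
    (ht : 3 ≤ x.deg t) :
    ∃ y, Rearranges x y ∧ (∀ v, y.deg v = x.deg v) ∧ ∃ a b c, y.IsTriangle a b c := by
  classical
  induction n generalizing x s v with
  | zero => exact absurd (SimpleGraph.Walk.eq_of_length_eq_zero hn) hst
  | succ n ih =>
    obtain ⟨w, hw⟩ := exists_forall_mem_edges_eq p hp
    cases p with
    | nil => simp at hn
    | @cons _ r _ hsr p =>
      by_cases hts : x.graph.Adj t s
      · exact ⟨x, .refl x, fun _ => rfl, t, v, s, htv, hts, hvs⟩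
      obtain ⟨q, hq, hqF⟩ := exists_adj_notMem (x := x) (v := t) {v, w}
        (Finset.card_le_two.trans_lt (by omega))
      simp only [Finset.mem_insert, Finset.mem_singleton, not_or] at hqF
      by_cases hvq : x.graph.Adj v q
      · exact ⟨x, .refl x, fun _ => rfl, t, v, q, htv, hq, hvq⟩
      have hr : (r2 t v q s).Applicable x := ⟨htv, hq, hqF.1, hvq, hvs, hst, hts⟩
      have hedge : ∀ e ∈ (SimpleGraph.Walk.cons hsr p).edges,
          e ∈ ((r2 t v q s).result x).graph.edgeSet := by
        intro e he
        induction e with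
        | h a b =>
          have hab := SimpleGraph.Walk.adj_of_mem_edges _ he
          refine (result_adj _ _ _ _).2 ⟨Or.inl ⟨hab, ?_⟩, hab.ne⟩
          rintro (heq | heq) <;> rw [heq] at he
          · exact hqF.2 (hw q he)
          · exact hvp (SimpleGraph.Walk.fst_mem_support_of_mem_edges _ he)
      rw [SimpleGraph.Walk.cons_isPath_iff] at hp
      have hedge' : ∀ e ∈ p.edges, e ∈ ((r2 t v q s).result x).graph.edgeSet :=
        fun e he => hedge e (by simp [he])
      obtain ⟨y, hy, hd, hT⟩ := ih _ (v := s) (p.transfer _ hedge') (hp.1.transfer hedge')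
        (by simpa using hn) ((result_adj _ _ _ _).2 ⟨Or.inr (by simp [added]), hst.symm⟩)
        (hedge s(s, r) (by simp)) (by simpa using hp.2) (fun e => hts (e ▸ hsr.symm))
        (by rwa [deg_r2 hr])
      exact ⟨y, (rearranges_r2 hr).trans hy, fun u => (hd u).trans (deg_r2 hr u), hT⟩

lemma exists_rearranges_isTriangle {V : Type*} [Fintype V] (x : LabeledGraph V)
    (hx : x.graph.Connected) (hdeg : ∀ v, 3 ≤ x.deg v) :
    ∃ y, Rearranges x y ∧ (∀ v, y.deg v = x.deg v) ∧ ∃ a b c, y.IsTriangle a b c := by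
  classical
  -- A tree has fewer edges than nodes, too few for minimum degree 3.
  have hcyc : ¬ x.graph.IsAcyclic := by
    intro hac
    have h1 := (SimpleGraph.IsTree.mk hx hac).card_edgeFinset
    have h2 := x.sum_deg
    have h3 : ∑ _v : V, 3 ≤ ∑ v, x.deg v := Finset.sum_le_sum fun v _ => hdeg v
    have := hx.nonempty
    have := Fintype.card_pos (α := V)
    rw [size, ← SimpleGraph.coe_edgeFinset, Set.ncard_coe_finset] at h2
    simp only [Finset.sum_const, Finset.card_univ, smul_eq_mul] at h3
    omega
  unfold SimpleGraph.IsAcyclic at hcyc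
  push Not at hcyc
  obtain ⟨t, c, hc⟩ := hcyc
  cases c with
  | nil => exact absurd hc SimpleGraph.Walk.not_isCycle_nil
  | @cons _ v _ htv c =>
    rw [SimpleGraph.Walk.cons_isCycle_iff] at hc
    cases c with
    | nil => exact absurd htv (SimpleGraph.irrefl _)
    | @cons _ s _ hvs p =>
      have hp := (SimpleGraph.Walk.cons_isPath_iff _ _).1 hc.1
      refine exists_rearranges_isTriangle_of_path _ x p hp.1 rfl htv hvs hp.2 ?_ (hdeg t)
      rintro rfl
      exact hc.2 (by simp [Sym2.eq_swap])

/-! ### Reaching a regular graph -/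

lemma exists_reach_size_pred {V : Type*} [Fintype V] {x : LabeledGraph V}
    (hx : x.graph.Connected) (hreg : ∀ m, ¬ x.IsRegular m) {k : ℕ} (hk : 3 ≤ k)
    (hdeg : ∀ v, k ≤ x.deg v ∧ x.deg v ≤ k + 1) {v : V} (hv : x.flag v = 1) :
    ∃ y, Reach x y ∧ y.size + 1 = x.size := by
  suffices h : ∃ y, Rearranges x y ∧ y.HasUnevenTriangle by
    obtain ⟨y, hy, hT⟩ := h
    obtain ⟨z, hz, hs⟩ := hT.exists_reach_size_pred (hy.1.connected hx) (v := v) (by rw [hy.2, hv])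
    exact ⟨z, hy.1.trans hz, hs.trans hy.size_eq⟩
  obtain ⟨y, hy, hd, a, b, c, hT⟩ := exists_rearranges_isTriangle x hx
    fun v => hk.trans (hdeg v).1
  by_cases hb : y.deg a ≠ y.deg b
  · exact ⟨y, hy, .of_ne hT.1 hT.2.1 hT.2.2 hb⟩
  by_cases hc : y.deg a ≠ y.deg c
  · exact ⟨y, hy, .of_ne hT.2.1 hT.1 hT.2.2.symm hc⟩
  push Not at hb hc
  obtain ⟨u, hu⟩ : ∃ u, y.deg u ≠ y.deg a := by
    by_contra! hall
    exact hreg (y.deg a) fun u => (hd u).symm.trans (hall u)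
  obtain ⟨p, hp⟩ := ((hy.1.connected hx).preconnected u a).exists_isPath
  obtain ⟨z, hz, hz'⟩ := IsTriangle.exists_hasUnevenTriangle _ y p hp rfl hT rfl hb.symm hc.symm
    hu hk (by simpa [hd] using hdeg)
  exact ⟨z, hy.trans hz, hz'⟩

lemma exists_reach_isRegular {V : Type*} [Fintype V] {x : LabeledGraph V} {c q : ℕ}
    (hx : x.graph.Connected) (hsize : x.size = c + x.flagSum) (hq : 2 ≤ q)
    (hc : c ≤ q * Fintype.card V) (hc' : q * Fintype.card V < c + Fintype.card V) :
    ∃ y m, Reach x y ∧ y.IsRegular m := by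
  -- With truncated subtraction this sum is the distance from the size to its target.
  induction hN : (x.size - q * Fintype.card V) + (q * Fintype.card V - x.size)
    using Nat.strong_induction_on generalizing x with
  | _ N ih =>
    subst hN
    obtain ⟨y, hy, hbal⟩ := exists_rearranges_balanced x hx
    by_cases hreg : ∃ m, y.IsRegular m
    · obtain ⟨m, hm⟩ := hreg
      exact ⟨y, m, hy.1, hm⟩
    push Not at hreg
    have hyc := hy.1.connected hx
    have hxs := hy.size_eq
    have hys : y.size = c + y.flagSum := by
      have := hy.1.size_add_flagSum
      omega
    have next : ∀ z, Reach y z → (z.size - q * Fintype.card V) + (q * Fintype.card V - z.size) <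
        (x.size - q * Fintype.card V) + (q * Fintype.card V - x.size) →
        ∃ y m, Reach x y ∧ y.IsRegular m := by
      intro z hz hlt
      have := hz.size_add_flagSum
      obtain ⟨y', m, h1, h2⟩ := ih _ hlt (hz.connected hyc) (by omega) rfl
      exact ⟨y', m, hy.1.trans (hz.trans h1), h2⟩
    have hsum := y.sum_deg
    have := hyc.nonempty
    rcases lt_trichotomy y.size (q * Fintype.card V) with hlt | heq | hgt
    · obtain ⟨v, hv⟩ : ∃ v, y.flag v = 0 := by
        by_contra! hall
        have : y.flagSum = ∑ _v : V, 1 := Finset.sum_congr rfl fun v _ => by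
          have := hall v
          omega
        simp at this
        omega
      obtain ⟨z, hz, hs⟩ := exists_reach_size_succ hyc hreg hv
      exact next z hz (by omega)
    · exfalso
      have hcon : ∑ v, y.deg v = ∑ _v : V, 2 * q := by
        simp only [Finset.sum_const, Finset.card_univ, smul_eq_mul]
        rw [hsum, heq]; ring
      refine hreg (2 * q) fun v => ?_
      rcases lt_trichotomy (y.deg v) (2 * q) with h | h | h
      · have : ∑ v, y.deg v < ∑ _v : V, 2 * q := Finset.sum_lt_sum
          (fun u _ => by have := hbal u v; omega) ⟨v, Finset.mem_univ _, h⟩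
        omega
      · exact h
      · have : ∑ _v : V, 2 * q < ∑ v, y.deg v := Finset.sum_lt_sum
          (fun u _ => by have := hbal v u; omega) ⟨v, Finset.mem_univ _, h⟩
        omega
    · obtain ⟨v, hv⟩ : ∃ v, y.flag v = 1 := by
        by_contra! hall
        have : y.flagSum = ∑ _v : V, 0 := Finset.sum_congr rfl fun v _ => by
          have := hall v
          omega
        simp at this
        omega
      obtain ⟨u, -, hmin⟩ := Finset.exists_min_image Finset.univ y.deg Finset.univ_nonempty
      -- Since `q ≥ 2`, the average degree exceeds 4, whereas a node of degree at most 2 would cap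
      -- all degrees at 3.
      have hu : 3 ≤ y.deg u := by
        by_contra! hlt
        have : ∑ v, y.deg v ≤ ∑ _v : V, 3 :=
          Finset.sum_le_sum fun v _ => by have := hbal v u; omega
        simp only [Finset.sum_const, Finset.card_univ, smul_eq_mul] at this
        have : 2 * Fintype.card V ≤ q * Fintype.card V := by gcongr
        omega
      obtain ⟨z, hz, hs⟩ := exists_reach_size_pred hyc hreg hu
        (fun w => ⟨hmin w (Finset.mem_univ w), hbal w u⟩) hv
      exact next z hz (by omega)

end LabeledGraph

/-! ### From reachability to the random process -/

namespace IsRandomExecution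

open LabeledGraph RuleInstance

variable {V : Type*} [Fintype V] {P : LabeledGraph V → PMF (LabeledGraph V)}

lemma reach_of_ne_zero (hP : IsRandomExecution P) {x y : LabeledGraph V} (h : P x y ≠ 0) :
    Reach x y :=
  (hP.feasible x y h).elim fun _ hS => hS.reach

lemma reflTransGen_of_reach (hP : IsRandomExecution P) {x y : LabeledGraph V} (h : Reach x y) :
    Relation.ReflTransGen (fun x y => P x y ≠ 0) x y := by
  induction h with
  | refl => exact .refl
  | @tail y z _ hyz ih =>
    obtain ⟨r, hr, rfl⟩ := hyz
    by_cases heq : y = r.result y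
    · rwa [← heq]
    · exact ih.tail (hP.positive _ _ r heq (appliesTo_result hr))

end IsRandomExecution

open LabeledGraph in
theorem mainTheorem2 {V : Type*} [Fintype V] (G : LabeledGraph V)
    (hconn : G.graph.Connected) (hflag : ∀ v, G.flag v = 0) (hdeg : 2 < G.avgDegree)
    (P : LabeledGraph V → PMF (LabeledGraph V)) (hP : IsRandomExecution P)
    {Ω : Type*} [MeasurableSpace Ω] (μ : MeasureTheory.Measure Ω)
    [MeasureTheory.IsProbabilityMeasure μ] (X : ℕ → Ω → LabeledGraph V)
    (hX : IsMarkovChain μ X G P) :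
    ∀ᵐ ω ∂μ, ∃ (t m : ℕ),
      (X t ω).IsRegular m ∧ G.avgDegree ≤ (m : ℝ) ∧ (m : ℝ) ≤ G.avgDegree + 2 := by
  have hne := hconn.nonempty
  have hn : 0 < Fintype.card V := Fintype.card_pos
  have hnR : (0 : ℝ) < Fintype.card V := by exact_mod_cast hn
  have hG0 : G.flagSum = 0 := by simp [flagSum, hflag]
  have havg : G.avgDegree = 2 * G.size / Fintype.card V := by
    rw [avgDegree, ← Nat.cast_sum, sum_deg]
    push_cast
    rfl
  have hcard : Fintype.card V < G.size := by
    rw [havg, lt_div_iff₀ hnR] at hdeg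
    have : (Fintype.card V : ℝ) < G.size := by linarith
    exact_mod_cast this
  obtain ⟨q, hq, hq'⟩ : ∃ q, G.size ≤ q * Fintype.card V ∧
      q * Fintype.card V < G.size + Fintype.card V := by
    -- This is the quotient of `G.size` by the number of nodes, rounded up.
    refine ⟨(G.size + Fintype.card V - 1) / Fintype.card V, ?_, ?_⟩
    · have := Nat.lt_div_mul_add (a := G.size + Fintype.card V - 1) hn
      omega
    · have := Nat.div_mul_le_self (G.size + Fintype.card V - 1) (Fintype.card V)
      omega
  have hq2 : 2 ≤ q := by
    by_contra! hlt
    have : q * Fintype.card V ≤ 1 * Fintype.card V := by gcongr; omega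
    omega
  have hhit := hX.ae_exists_mem (A := {y | ∃ m : ℕ,
      y.IsRegular m ∧ G.avgDegree ≤ (m : ℝ) ∧ (m : ℝ) ≤ G.avgDegree + 2}) (R := {y | Reach G y})
    (Relation.ReflTransGen.refl) (fun x hx y hxy => hx.trans (hP.reach_of_ne_zero hxy)) ?_
  · filter_upwards [hhit] with ω hω
    exact hω
  · intro x hx
    have hxs := Reach.size_add_flagSum hx
    obtain ⟨y, m, hxy, hreg⟩ := exists_reach_isRegular (x := x) (c := G.size)
      (Reach.connected hx hconn) (by omega) hq2 hq hq'
    refine ⟨y, ⟨m, hreg, ?_⟩, hP.reflTransGen_of_reach hxy⟩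
    have hys := hxy.size_add_flagSum
    -- The invariant and this bound confine `y.size` to an interval of length `Fintype.card V`
    -- starting at `G.size`; doubling and dividing by the number of nodes gives the window of width
    -- 2 for `m`.
    have hfs := y.flagSum_le
    have hsum : Fintype.card V * m = 2 * y.size := by
      rw [← sum_deg, Finset.sum_congr rfl fun v _ => hreg v]
      simp
    have hsumR : (Fintype.card V : ℝ) * m = 2 * y.size := by exact_mod_cast hsum
    have h1 : (G.size : ℝ) ≤ y.size := by
      have : G.size ≤ y.size := by omega
      exact_mod_cast this
    have h2 : (y.size : ℝ) ≤ G.size + Fintype.card V := by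
      have : y.size ≤ G.size + Fintype.card V := by omega
      exact_mod_cast this
    rw [havg, div_le_iff₀ hnR, ← sub_le_iff_le_add, le_div_iff₀ hnR]
    constructor <;> nlinarith
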